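/- **Theorem 5.2.** Let $\lambda_1,\lambda_2,\lambda_3,\lambda_4,\lambda_S,\lambda_{S1},\lambda_{S2},\lambda_{S12},\rho$ be real numbers with $0\le\rho\le 1$, and let $$f(h_1,h_2,s)=\lambda_1h_1^4+\lambda_2h_2^4+\lambda_3h_1^2h_2^2+\lambda_4\rho^2h_1^2h_2^2+\lambda_Ss^4+\lambda_{S1}s^2h_1^2+\lambda_{S2}s^2h_2^2-|\lambda_{S12}|\rho\,s^2h_1h_2 ,$$ $$\alpha(1,t)=\lambda_{S1}-|\lambda_{S12}|\rho\,t+\lambda_{S2}t^2,\qquad \beta(1,t)=\lambda_1+(\lambda_3+\lambda_4\rho^2)t^2+\lambda_2t^4,$$ $$g(t)=4\lambda_S\beta(1,t)-\alpha(1,t)^2=b_0t^4+b_1t^3+b_2t^2+b_3t+b_4 .$$ *The Ulrich–Watson criterion.* A polynomial $at^4+bt^3+ct^2+dt+e$ is said to satisfy the criterion if $a>0$, $e>0$ and, with $A=ba^{-3/4}e^{-1/4}$, $B=ca^{-1/2}e^{-1/2}$, $\Gamma=da^{-1/4}e^{-3/4}$, $$\begin{aligned} D&=4(B^2-3A\Gamma+12)^3-(72B+9AB\Gamma-2B^3-27A^2-27\Gamma^2)^2,\\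 \mu&=(A-\Gamma)^2-16(A+B+\Gamma+2),\\ \eta&=(A-\Gamma)^2-\tfrac{4(B+2)}{\sqrt{B-2}}\bigl(A+\Gamma+4\sqrt{B-2}\bigr)\quad(\text{used for }B>6),\end{aligned}$$ one of the following holds: $B<-2$, $D\le0$ and $A+\Gamma>0$; or $-2\le B\le 6$ and [($D\le0$ and $A+\Gamma>0$) or ($D\ge0$ and $\mu\le0$)]; or $B>6$ and [($D\le0$ and $A+\Gamma>0$) or ($A>0$ and $\Gamma>0$) or ($D\ge0$ and $\eta\le0$)]. Let $\Delta=(\lambda_{S12}\rho)^2-4\lambda_{S1}\lambda_{S2}$ and, where they are used (that is, for $\lambda_{S2}\ne0$ and $\Delta>0$), $$\bar t_1=\frac{|\lambda_{S12}|\rho-\sqrt{\Delta}}{2\lambda_{S2}},\qquad \bar t_2=\tilde t=\frac{|\lambda_{S12}|\rho+\sqrt{\Delta}}{2\lambda_{S2}},\qquad \bar t=\max\{\bar t_1,0\}.$$ Consider the following two conditions. (1) $\lambda_S\ge0$, $\lambda_1\ge0$, $\lambda_2\ge0$, $\lambda_3+\lambda_4\rho^2\ge-2\sqrt{\lambda_1\lambda_2}$,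 $\lambda_{S1}\ge-2\sqrt{\lambda_S\lambda_1}$, $\lambda_{S2}\ge-2\sqrt{\lambda_S\lambda_2}$. (2) At least one of the following holds: (a) $\lambda_{S1}\ge0$, $\lambda_{S2}\ge0$ and $|\lambda_{S12}|\rho\le2\sqrt{\lambda_{S1}\lambda_{S2}}$; (b) $\lambda_{S1}\le0$, $\lambda_{S2}\le0$, and $g$ satisfies the criterion; (c) $\lambda_{S2}=0$, $|\lambda_{S12}|\rho\neq0$, $b_0=4\lambda_S\lambda_2\ge0$, $b_1=0$, and $g_1(u)=g(u+\bar\lambda)$ satisfies the criterion, where $\bar\lambda=\max\{\lambda_{S1}/(|\lambda_{S12}|\rho),0\}$; (d) $\lambda_{S2}>0$, $\Delta>0$, and $g_3(u)=g_2\bigl(u+\frac1{\tilde t-\bar t}\bigr)$ satisfies the criterion, where $g_2(u)=u^4g(\frac1u+\bar t)$; (e) $\lambda_{S2}<0$, $\Delta>0$, $\bar t_1\ge0$, and both $g_4(u)=g_7\bigl(u-\frac1{\bar t_2-\bar t_1}\bigr)$, where $g_7(u)=u^4g(\frac1u+\bar t_1)$, and $g_5(u)=g(u-\bar t_2)$ satisfy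 the criterion; (f) $\lambda_{S2}<0$, $\Delta>0$, $\bar t_1<0$, and $g_6(u)=g(u+\bar t_2)$ satisfies the criterion. Then: * If (1) and (2) hold, then $f(h_1,h_2,s)\ge0$ for all $h_1,h_2,s\ge0$. * If $f(h_1,h_2,s)\ge0$ for all $h_1,h_2,s\ge0$, then (1) holds. * Suppose that (a) holds or that, in the first of the cases (b)–(f) whose conditions on the couplings (everything but the criterion) hold, every quartic to be tested has nonzero coefficient of degree $4$ and nonzero constant coefficient. Then $f(h_1,h_2,s)\ge0$ for all $h_1,h_2,s\ge0$ **if and only if** (1) and (2) hold. -/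

import Mathlib

open Polynomial

noncomputable section

namespace Z3DarkMatter

/-- The real parameters of the scalar potential: `lam1, …, lam4` are the couplings `λ₁, …, λ₄`,
`lamS, lamS1, lamS2, lamS12` are `λ_S, λ_{S1}, λ_{S2}, λ_{S12}`, and `rho` is `ρ`. -/
structure Params where
  lam1 : ℝ
  lam2 : ℝ
  lam3 : ℝ
  lam4 : ℝ
  lamS : ℝ
  lamS1 : ℝ
  lamS2 : ℝ
  lamS12 : ℝ
  rho : ℝ

namespace Params

variable (P : Params)

/-- The scalar potential `f(h₁, h₂, s)`. -/
def potential (h₁ h₂ s : ℝ) : ℝ :=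
  P.lam1 * h₁ ^ 4 + P.lam2 * h₂ ^ 4 + P.lam3 * h₁ ^ 2 * h₂ ^ 2
    + P.lam4 * P.rho ^ 2 * h₁ ^ 2 * h₂ ^ 2 + P.lamS * s ^ 4
    + P.lamS1 * s ^ 2 * h₁ ^ 2 + P.lamS2 * s ^ 2 * h₂ ^ 2
    - |P.lamS12| * P.rho * s ^ 2 * h₁ * h₂

/-- The quadratic form `α(x₁, x₂)`, the coefficient of `s²` in the potential. -/
def alpha (x₁ x₂ : ℝ) : ℝ :=
  P.lamS1 * x₁ ^ 2 - |P.lamS12| * P.rho * x₁ * x₂ + P.lamS2 * x₂ ^ 2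

/-- The quartic form `β(x₁, x₂)`, the part of the potential that is free of `s`. -/
def beta (x₁ x₂ : ℝ) : ℝ :=
  P.lam1 * x₁ ^ 4 + (P.lam3 + P.lam4 * P.rho ^ 2) * x₁ ^ 2 * x₂ ^ 2 + P.lam2 * x₂ ^ 4

theorem potential_eq (h₁ h₂ s : ℝ) :
    P.potential h₁ h₂ s = P.lamS * s ^ 4 + P.alpha h₁ h₂ * s ^ 2 + P.beta h₁ h₂ := by
  unfold potential alpha beta
  ring

/-- The polynomial `g(t) = 4 λ_S β(1, t) - α(1, t)²`. -/
def g : ℝ[X] :=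
  C (4 * P.lamS) * (C P.lam1 + C (P.lam3 + P.lam4 * P.rho ^ 2) * X ^ 2 + C P.lam2 * X ^ 4)
    - (C P.lamS1 - C (|P.lamS12| * P.rho) * X + C P.lamS2 * X ^ 2) ^ 2

theorem eval_g (t : ℝ) : P.g.eval t = 4 * P.lamS * P.beta 1 t - P.alpha 1 t ^ 2 := by
  simp [g, alpha, beta]

end Params

/-- The polynomial `u ↦ q(u + r)`. -/
def shift (q : ℝ[X]) (r : ℝ) : ℝ[X] := q.comp (X + C r)

theorem eval_shift (q : ℝ[X]) (r u : ℝ) : (shift q r).eval u = q.eval (u + r) := by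
  simp [shift]

/-- For a polynomial `q` of degree at most `4`, the polynomial `u ↦ u⁴ q(1/u + r)`: the
coefficients of `q(u + r)` in reverse order. -/
def invert (q : ℝ[X]) (r : ℝ) : ℝ[X] := (shift q r).reflect 4

theorem eval_invert (q : ℝ[X]) (hq : q.natDegree ≤ 4) (r u : ℝ) (hu : u ≠ 0) :
    (invert q r).eval u = u ^ 4 * q.eval (1 / u + r) := by
  have hd : (shift q r).natDegree ≤ 4 := by
    rw [shift, natDegree_comp, natDegree_X_add_C, mul_one]
    exact hq
  have hs : ∀ p : ℝ[X], p.natDegree ≤ 4 →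
      (p.reflect 4).eval u = u ^ 4 * p.eval (1 / u) := by
    intro p hp
    have : Invertible (1 / u) := invertibleOfNonzero (one_div_ne_zero hu)
    have h := eval₂_reflect_mul_pow (RingHom.id ℝ) (1 / u) 4 p hp
    simp only [eval₂_id, invOf_eq_inv, one_div, inv_inv] at h ⊢
    rw [← h]
    field_simp
  rw [invert, hs _ hd, eval_shift]

theorem natDegree_g_le (P : Params) : P.g.natDegree ≤ 4 := by
  unfold Params.g
  compute_degree

/-- The normalized coefficients and invariants in the criterion of Ulrich and Watson for
`a t⁴ + b t³ + c t² + d t + e ≥ 0` on `t > 0`; the criterion is about quartics with `a > 0` and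
`e > 0`, and these two inequalities are part of it. -/
def UlrichWatson (a b c d e : ℝ) : Prop :=
  0 < a ∧ 0 < e ∧
    let α : ℝ := b * a ^ (-(3 / 4) : ℝ) * e ^ (-(1 / 4) : ℝ)
    let β : ℝ := c * a ^ (-(1 / 2) : ℝ) * e ^ (-(1 / 2) : ℝ)
    let γ : ℝ := d * a ^ (-(1 / 4) : ℝ) * e ^ (-(3 / 4) : ℝ)
    let Δ : ℝ := 4 * (β ^ 2 - 3 * α * γ + 12) ^ 3
      - (72 * β + 9 * α * β * γ - 2 * β ^ 3 - 27 * α ^ 2 - 27 * γ ^ 2) ^ 2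
    let μ : ℝ := (α - γ) ^ 2 - 16 * (α + β + γ + 2)
    let η : ℝ := (α - γ) ^ 2
      - 4 * (β + 2) / √(β - 2) * (α + γ + 4 * √(β - 2))
    (β < -2 ∧ Δ ≤ 0 ∧ 0 < α + γ) ∨
    ((-2 ≤ β ∧ β ≤ 6) ∧ ((Δ ≤ 0 ∧ 0 < α + γ) ∨ (0 ≤ Δ ∧ μ ≤ 0))) ∨
    (6 < β ∧ ((Δ ≤ 0 ∧ 0 < α + γ) ∨ (0 < α ∧ 0 < γ) ∨ (0 ≤ Δ ∧ η ≤ 0)))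

/-- The coefficients of the quartic `q` satisfy the Ulrich–Watson criterion. -/
def SatisfiesUW (q : ℝ[X]) : Prop :=
  UlrichWatson (q.coeff 4) (q.coeff 3) (q.coeff 2) (q.coeff 1) (q.coeff 0)

/-- The coefficient of degree four and the constant coefficient of `q` do not vanish. -/
def NonzeroEnds (q : ℝ[X]) : Prop := q.coeff 4 ≠ 0 ∧ q.coeff 0 ≠ 0

namespace Params

variable (P : Params)

/-- The discriminant `(λ_{S12} ρ)² - 4 λ_{S1} λ_{S2}` of `α(1, ·)`. -/
def disc : ℝ := (P.lamS12 * P.rho) ^ 2 - 4 * P.lamS1 * P.lamS2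

/-- `(|λ_{S12}| ρ - √disc) / (2 λ_{S2})`. -/
def tMinus : ℝ := (|P.lamS12| * P.rho - √P.disc) / (2 * P.lamS2)

/-- `(|λ_{S12}| ρ + √disc) / (2 λ_{S2})`. -/
def tPlus : ℝ := (|P.lamS12| * P.rho + √P.disc) / (2 * P.lamS2)

/-- `max {λ_{S1} / (|λ_{S12}| ρ), 0}`. -/
def lamBar : ℝ := max (P.lamS1 / (|P.lamS12| * P.rho)) 0

/-- `max {tMinus, 0}`. -/
def tBar : ℝ := max P.tMinus 0

/-- `g₁(u) = g(u + lamBar)`. -/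
def g1 : ℝ[X] := shift P.g P.lamBar

/-- `g₂(u) = u⁴ g(1/u + tBar)`. -/
def g2 : ℝ[X] := invert P.g P.tBar

/-- `g₃(u) = g₂(u + 1/(tPlus - tBar))`. -/
def g3 : ℝ[X] := shift P.g2 (1 / (P.tPlus - P.tBar))

/-- `g₇(u) = u⁴ g(1/u + tMinus)`. -/
def g7 : ℝ[X] := invert P.g P.tMinus

/-- `g₄(u) = g₇(u - 1/(tPlus - tMinus))`. -/
def g4 : ℝ[X] := shift P.g7 (-(1 / (P.tPlus - P.tMinus)))

/-- `g₅(u) = g(u - tPlus)`. -/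
def g5 : ℝ[X] := shift P.g (-P.tPlus)

/-- `g₆(u) = g(u + tPlus)`. -/
def g6 : ℝ[X] := shift P.g P.tPlus

/-- The potential is nonnegative on the nonnegative orthant. -/
def PotentialNonneg : Prop :=
  ∀ h₁ h₂ s : ℝ, 0 ≤ h₁ → 0 ≤ h₂ → 0 ≤ s → 0 ≤ P.potential h₁ h₂ s

/-- Condition (1): the explicit inequalities. -/
def Condition1 : Prop :=
  0 ≤ P.lamS ∧ 0 ≤ P.lam1 ∧ 0 ≤ P.lam2 ∧
    -2 * √(P.lam1 * P.lam2) ≤ P.lam3 + P.lam4 * P.rho ^ 2 ∧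
    -2 * √(P.lamS * P.lam1) ≤ P.lamS1 ∧
    -2 * √(P.lamS * P.lam2) ≤ P.lamS2

/-- Case (a). -/
def CaseA : Prop :=
  0 ≤ P.lamS1 ∧ 0 ≤ P.lamS2 ∧ |P.lamS12| * P.rho ≤ 2 * √(P.lamS1 * P.lamS2)

/-- The hypotheses on the couplings under which case (b) applies. -/
def SideB : Prop := P.lamS1 ≤ 0 ∧ P.lamS2 ≤ 0

/-- The hypotheses on the couplings under which case (c) applies. -/
def SideC : Prop :=
  P.lamS2 = 0 ∧ |P.lamS12| * P.rho ≠ 0 ∧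
    P.g.coeff 4 = 4 * P.lamS * P.lam2 ∧ 0 ≤ 4 * P.lamS * P.lam2 ∧ P.g.coeff 3 = 0

/-- The hypotheses on the couplings under which case (d) applies. -/
def SideD : Prop := 0 < P.lamS2 ∧ 0 < P.disc

/-- The hypotheses on the couplings under which case (e) applies. -/
def SideE : Prop := P.lamS2 < 0 ∧ 0 < P.disc ∧ 0 ≤ P.tMinus

/-- The hypotheses on the couplings under which case (f) applies. -/
def SideF : Prop := P.lamS2 < 0 ∧ 0 < P.disc ∧ P.tMinus < 0

/-- Condition (2): one of the cases (a)–(f) holds. -/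
def Condition2 : Prop :=
  P.CaseA ∨
  (P.SideB ∧ SatisfiesUW P.g) ∨
  (P.SideC ∧ SatisfiesUW P.g1) ∨
  (P.SideD ∧ SatisfiesUW P.g3) ∨
  (P.SideE ∧ SatisfiesUW P.g4 ∧ SatisfiesUW P.g5) ∨
  (P.SideF ∧ SatisfiesUW P.g6)

/-- Nondegeneracy: unless case (a) holds, the quartics to be tested in the first of the cases
(b)–(f) whose hypotheses on the couplings hold have nonzero coefficient of degree four and nonzero
constant coefficient. -/
def Nondegenerate : Prop :=
  P.CaseA ∨
  ((P.SideB → NonzeroEnds P.g) ∧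
    (¬ P.SideB →
      (P.SideC → NonzeroEnds P.g1) ∧
      (P.SideD → NonzeroEnds P.g3) ∧
      (P.SideE → NonzeroEnds P.g4 ∧ NonzeroEnds P.g5) ∧
      (P.SideF → NonzeroEnds P.g6)))

end Params

end Z3DarkMatter

end

/-!
For `h₁, h₂` fixed, the potential is a quadratic in `s²`, with coefficients `λ_S`, `α(h₁, h₂)` and
`β(h₁, h₂)`. Under the explicit inequalities, which come from the three faces `s = 0`, `h₁ = 0`,
`h₂ = 0` of the orthant and make `β` nonnegative, it is nonnegative for all `s` iff
`4 λ_S β ≥ α²` or `α ≥ 0`. By homogeneity the question is therefore whether `g ≥ 0` on the set of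
`t > 0` where `α(1, t) < 0` (`potentialNonneg_iff`). This set is empty or, up to
points where `α` vanishes, an interval or a half-line whose position depends on the signs of the
couplings; unless it is `(0, ∞)` itself, the substitutions that define `g₁`, `g₃`, `g₄`, `g₅` carry
`(0, ∞)` onto it or onto pieces that cover it up to a point. What remains is that the
Ulrich–Watson criterion decides whether a quartic with positive end coefficients is nonnegative
on `(0, ∞)` (`ulrichWatson_iff`).

To prove the criterion, normalize the quartic to `t⁴ + α t³ + β t² + γ t + 1`. The resolvent cubic
has a root that yields a factorization
`(t² + κ M t + κ²) (t² + l N t + l²)` with `κ, l > 0` and `κ l = 1` (`exists_factorization`).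
A factor changes sign on `(0, ∞)` exactly when its `M` or `N` is less than `-2`, so the product is
nonnegative there iff `M, N ≥ -2` or the two factors coincide (`mul_nonneg_iff`).
With `K = κ + l`, the invariants of the criterion are functions of `M`, `N`, `K`:
`α + γ = (M + N) K`, `(α - γ)² = (M - N)² (K² - 4)`, `β = K² - 2 + M N`, and `Δ` equals
`27 (M² - 4) (N² - 4) R²` with `R` the resultant of the two factors (`discriminant_eq`). The
criterion is then verified separately according to the position of `M` and `N` relative to `±2`,
which comes down to the sign of `μ` and `η` (`mu_nonpos`, `eta_nonpos`, `mu_pos`,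
`eta_pos_of_both_neg`, `eta_pos_of_opposite`).
-/

namespace Z3DarkMatter

/-! ### Factorization of a quartic into two quadratics with positive constant terms -/

theorem exists_add_eq_mul_eq_one {K : ℝ} (hK : 2 ≤ K) :
    ∃ κ l : ℝ, 0 < κ ∧ 0 < l ∧ κ * l = 1 ∧ κ + l = K ∧ κ - l = √(K ^ 2 - 4) := by
  have h0 : 0 ≤ K ^ 2 - 4 := by nlinarith
  have hs := Real.sq_sqrt h0
  have hs0 := Real.sqrt_nonneg (K ^ 2 - 4)
  have hlt : √(K ^ 2 - 4) < K := by nlinarith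
  refine ⟨(K + √(K ^ 2 - 4)) / 2, (K - √(K ^ 2 - 4)) / 2, by linarith, by linarith, ?_, by ring,
    by ring⟩
  linear_combination -hs / 4

/-- Solvability of the equations for `K = κ + l`, `S = M + N`, `D = M - N` in the factorization
below. Eliminating `S` and `D` leaves a cubic in `Z = K²`, which is `-4 (A - Γ)²` at `Z = 4` and
positive for large `Z`. For `A = Γ` the root `Z = 4` may force `D² < 0`; another root `Z > 4` is
then available. -/
theorem exists_resolvent_root (A B Γ : ℝ) :
    ∃ K S D : ℝ, 2 ≤ K ∧ S * K = A + Γ ∧ D * √(K ^ 2 - 4) = A - Γ ∧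
      S ^ 2 - D ^ 2 = 4 * (B + 2 - K ^ 2) := by
  have two_le_sqrt : ∀ Z : ℝ, 4 ≤ Z → 2 ≤ √Z := fun Z hZ => Real.le_sqrt_of_sq_le (by linarith)
  rcases eq_or_ne A Γ with rfl | hne
  · rcases le_or_gt (4 * (B - 2)) (A ^ 2) with h | h
    · refine ⟨2, A, √(A ^ 2 - 4 * (B - 2)), le_rfl, by ring, by norm_num, ?_⟩
      rw [Real.sq_sqrt (by linarith)]
      ring
    · have hd : (B - 6) ^ 2 ≤ (B + 2) ^ 2 - 4 * A ^ 2 := by nlinarith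
      have hr := Real.sq_sqrt ((sq_nonneg (B - 6)).trans hd)
      have hr' : |B - 6| ≤ √((B + 2) ^ 2 - 4 * A ^ 2) := Real.abs_le_sqrt hd
      set r := √((B + 2) ^ 2 - 4 * A ^ 2)
      have h4 : 4 ≤ (B + 2 + r) / 2 := by linarith [neg_abs_le (B - 6)]
      have hK := two_le_sqrt _ h4
      refine ⟨√((B + 2 + r) / 2), 2 * A / √((B + 2 + r) / 2), 0, hK, ?_, by ring, ?_⟩
      · field_simp
        ring
      · have hne : B + 2 + r ≠ 0 := by linarith
        rw [div_pow, Real.sq_sqrt (by linarith)]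
        field_simp
        linear_combination 4 * hr
  · have hpos : 0 < (A - Γ) ^ 2 := by
      have := sub_ne_zero.2 hne
      positivity
    let h : ℝ → ℝ := fun Z =>
      (A + Γ) ^ 2 * (Z - 4) + 4 * (Z - B - 2) * Z * (Z - 4) - (A - Γ) ^ 2 * Z
    have hc : Continuous h := by fun_prop
    have hB := le_abs_self B
    have hB0 := abs_nonneg B
    have hle : (4 : ℝ) ≤ |B| + 6 + (A - Γ) ^ 2 := by linarith
    obtain ⟨Z, ⟨hZ4, -⟩, hZ⟩ := intermediate_value_Icc hle hc.continuousOn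
      (show (0 : ℝ) ∈ Set.Icc (h 4) (h (|B| + 6 + (A - Γ) ^ 2)) by
        constructor
        · simp only [h]
          nlinarith
        · simp only [h]
          set E := (A - Γ) ^ 2
          have h1 : 0 ≤ (A + Γ) ^ 2 * (|B| + 6 + E - 4) := by
            have : 0 ≤ |B| + 6 + E - 4 := by linarith
            positivity
          have h2 : E ≤ 4 * (|B| + 6 + E - B - 2) * (|B| + 6 + E - 4) := by nlinarith
          nlinarith)
    simp only [h] at hZ
    have hZ4' : 0 < Z - 4 := by
      rcases hZ4.eq_or_lt with rfl | h'
      · nlinarith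
      · linarith
    have hK := two_le_sqrt _ hZ4
    have hsq : √Z ^ 2 = Z := Real.sq_sqrt (by linarith)
    have hs4 := Real.sqrt_pos.2 hZ4'
    refine ⟨√Z, (A + Γ) / √Z, (A - Γ) / √(Z - 4), hK, by field_simp, ?_, ?_⟩
    · rw [hsq]
      field_simp
    · rw [hsq, div_pow, div_pow, hsq, Real.sq_sqrt hZ4'.le]
      have : Z ≠ 0 := by linarith
      field_simp
      linear_combination hZ

/-- Every real quartic `t⁴ + A t³ + B t² + Γ t + 1` is a product of two real quadratics with positive
constant terms: real roots of the same sign are paired, as are complex conjugates. -/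
theorem exists_factorization (A B Γ : ℝ) :
    ∃ κ l M N : ℝ, 0 < κ ∧ 0 < l ∧ κ * l = 1 ∧
      A = κ * M + l * N ∧ B = κ ^ 2 + l ^ 2 + M * N ∧ Γ = l * M + κ * N := by
  obtain ⟨K, S, D, hK, hS, hD, hP⟩ := exists_resolvent_root A B Γ
  obtain ⟨κ, l, hκ, hl, hκl, hsum, hdiff⟩ := exists_add_eq_mul_eq_one hK
  rw [← hdiff] at hD
  subst hsum
  refine ⟨κ, l, (S + D) / 2, (S - D) / 2, hκ, hl, hκl, ?_, ?_, ?_⟩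
  · linear_combination -hS / 2 - hD / 2
  · linear_combination -hP / 4 + 2 * hκl
  · linear_combination -hS / 2 + hD / 2

theorem factorization_identity {κ l : ℝ} (h : κ * l = 1) (M N t : ℝ) :
    t ^ 4 + (κ * M + l * N) * t ^ 3 + (κ ^ 2 + l ^ 2 + M * N) * t ^ 2
      + (l * M + κ * N) * t + 1
      = (t ^ 2 + κ * M * t + κ ^ 2) * (t ^ 2 + l * N * t + l ^ 2) := by
  linear_combination (-M * N * t ^ 2 - l * M * t - κ * N * t - κ * l - 1) * h

/-- For `M < -2` the first factor has two simple positive roots. At each of them the product has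
a local minimum with value zero, so its derivative vanishes and the root is shared by the second
factor; hence the factors coincide. -/
theorem eq_of_mul_nonneg_of_lt_neg_two {κ l M N : ℝ} (hκ : 0 < κ) (hl : 0 < l) (hM : M < -2)
    (h : ∀ t : ℝ, 0 < t → 0 ≤ (t ^ 2 + κ * M * t + κ ^ 2) * (t ^ 2 + l * N * t + l ^ 2)) :
    M = N ∧ κ = l := by
  have hd : 0 < M ^ 2 - 4 := by nlinarith
  have hs := Real.sq_sqrt hd.le
  have hs0 := Real.sqrt_pos.2 hd
  -- The roots of the first factor are `κ (-M + σ) / 2` for the two square roots `σ` of `M² - 4`.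
  have key : ∀ σ : ℝ, σ ^ 2 = M ^ 2 - 4 →
      ((κ * (-M + σ) / 2) ^ 2 + l * N * (κ * (-M + σ) / 2) + l ^ 2) = 0 := by
    intro σ hσ
    have hr : 0 < κ * (-M + σ) / 2 := by
      have : 0 < -M + σ := by nlinarith
      positivity
    set r := κ * (-M + σ) / 2 with hrdef
    have hr0 : r ^ 2 + κ * M * r + κ ^ 2 = 0 := by
      rw [hrdef]
      linear_combination κ ^ 2 / 4 * hσ
    have hmin : IsLocalMin
        (fun t : ℝ => (t ^ 2 + κ * M * t + κ ^ 2) * (t ^ 2 + l * N * t + l ^ 2)) r := by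
      filter_upwards [lt_mem_nhds hr] with t ht
      simpa [hr0] using h t ht
    have hq : ∀ b c : ℝ, HasDerivAt (fun t : ℝ => t ^ 2 + b * t + c) (2 * r + b) r := by
      intro b c
      simpa using (((hasDerivAt_id r).pow 2).add ((hasDerivAt_id r).const_mul b)).add_const c
    have hz := hmin.hasDerivAt_eq_zero ((hq (κ * M) (κ ^ 2)).mul (hq (l * N) (l ^ 2)))
    rw [hr0, zero_mul, add_zero] at hz
    refine (mul_eq_zero.1 hz).resolve_left ?_
    have : 2 * r + κ * M = κ * σ := by rw [hrdef]; ring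
    rw [this]
    have : σ ≠ 0 := by
      rintro rfl
      nlinarith
    positivity
  set σ := √(M ^ 2 - 4)
  have h1 := key σ hs
  have h2 := key (-σ) (by rw [neg_sq, hs])
  have h3 : κ * M = l * N := by
    have : κ * σ * (l * N - κ * M) = 0 := by linear_combination h1 - h2
    have h' : κ * σ ≠ 0 := by positivity
    linarith [(mul_eq_zero.1 this).resolve_left h']
  have h4 : κ = l := by
    have : κ ^ 2 = l ^ 2 := by
      rw [← h3] at h1
      linear_combination -h1 + κ ^ 2 / 4 * hs
    nlinarith
  refine ⟨?_, h4⟩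
  subst h4
  exact mul_left_cancel₀ hκ.ne' h3

theorem mul_nonneg_iff {κ l M N : ℝ} (hκ : 0 < κ) (hl : 0 < l) :
    (∀ t : ℝ, 0 < t → 0 ≤ (t ^ 2 + κ * M * t + κ ^ 2) * (t ^ 2 + l * N * t + l ^ 2)) ↔
      (-2 ≤ M ∧ -2 ≤ N) ∨ (M = N ∧ κ = l) := by
  constructor
  · intro h
    rcases lt_or_ge M (-2) with hM | hM
    · exact Or.inr (eq_of_mul_nonneg_of_lt_neg_two hκ hl hM h)
    rcases lt_or_ge N (-2) with hN | hN
    · obtain ⟨h1, h2⟩ := eq_of_mul_nonneg_of_lt_neg_two hl hκ hN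
        (fun t ht => by rw [mul_comm]; exact h t ht)
      exact Or.inr ⟨h1.symm, h2.symm⟩
    · exact Or.inl ⟨hM, hN⟩
  · have hq : ∀ c m t : ℝ, 0 < c → -2 ≤ m → 0 < t → 0 ≤ t ^ 2 + c * m * t + c ^ 2 := by
      intro c m t hc hm ht
      nlinarith [sq_nonneg (t - c), mul_nonneg (mul_pos hc ht).le (by linarith : 0 ≤ m + 2)]
    rintro (⟨hM, hN⟩ | ⟨rfl, rfl⟩) t ht
    · exact mul_nonneg (hq κ M t hκ hM ht) (hq l N t hl hN ht)
    · exact mul_self_nonneg _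

/-! ### The invariants of the criterion in terms of the factorization -/

/-- The Ulrich–Watson conditions on the normalized coefficients, that is, for the quartic
`t⁴ + α t³ + β t² + γ t + 1`. -/
def UWMonic (α β γ : ℝ) : Prop :=
  let Δ : ℝ := 4 * (β ^ 2 - 3 * α * γ + 12) ^ 3
    - (72 * β + 9 * α * β * γ - 2 * β ^ 3 - 27 * α ^ 2 - 27 * γ ^ 2) ^ 2
  let μ : ℝ := (α - γ) ^ 2 - 16 * (α + β + γ + 2)
  let η : ℝ := (α - γ) ^ 2 - 4 * (β + 2) / √(β - 2) * (α + γ + 4 * √(β - 2))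
  (β < -2 ∧ Δ ≤ 0 ∧ 0 < α + γ) ∨
  ((-2 ≤ β ∧ β ≤ 6) ∧ ((Δ ≤ 0 ∧ 0 < α + γ) ∨ (0 ≤ Δ ∧ μ ≤ 0))) ∨
  (6 < β ∧ ((Δ ≤ 0 ∧ 0 < α + γ) ∨ (0 < α ∧ 0 < γ) ∨ (0 ≤ Δ ∧ η ≤ 0)))

/-- The quantity `Δ` of the criterion is `27` times the discriminant of the quartic. The
discriminant of a product is the product of the discriminants of the two factors and of the square
of their resultant. -/
theorem discriminant_eq {κ l : ℝ} (h : κ * l = 1) (M N : ℝ) {α β γ : ℝ}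
    (hα : α = κ * M + l * N) (hβ : β = κ ^ 2 + l ^ 2 + M * N) (hγ : γ = l * M + κ * N) :
    4 * (β ^ 2 - 3 * α * γ + 12) ^ 3
      - (72 * β + 9 * α * β * γ - 2 * β ^ 3 - 27 * α ^ 2 - 27 * γ ^ 2) ^ 2
    = 27 * (M ^ 2 - 4) * (N ^ 2 - 4) *
        (((κ + l) ^ 2 - 4) * ((κ + l) ^ 2 - M * N) + (M - N) ^ 2) ^ 2 := by
  have h1 : α * γ = M ^ 2 + N ^ 2 + M * N * ((κ + l) ^ 2 - 2) := by
    rw [hα, hγ]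
    linear_combination (M ^ 2 + N ^ 2 - 2 * M * N) * h
  have h2 : α ^ 2 + γ ^ 2 = (M ^ 2 + N ^ 2) * ((κ + l) ^ 2 - 2) + 4 * (M * N) := by
    rw [hα, hγ]
    linear_combination (4 * M * N - 2 * M ^ 2 - 2 * N ^ 2) * h
  have h3 : β = (κ + l) ^ 2 - 2 + M * N := by
    rw [hβ]
    linear_combination -2 * h
  have h4 : 4 * (β ^ 2 - 3 * α * γ + 12) ^ 3
      - (72 * β + 9 * α * β * γ - 2 * β ^ 3 - 27 * α ^ 2 - 27 * γ ^ 2) ^ 2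
      = 4 * (β ^ 2 - 3 * (α * γ) + 12) ^ 3
        - (72 * β + 9 * β * (α * γ) - 2 * β ^ 3 - 27 * (α ^ 2 + γ ^ 2)) ^ 2 := by ring
  rw [h4, h1, h2, h3]
  ring

/-- `μ ≤ 0` when each factor has no real root or a double one. With `S = M + N`, the claim is
`S² (K² - 4) - 16 S K ≤ 4 K² (M N + 4)`, and `2 |S| ≤ M N + 4` since `|M|, |N| ≤ 2`. -/
theorem mu_nonpos {M N K : ℝ} (hK : 2 ≤ K) (hM : |M| ≤ 2) (hN : |N| ≤ 2) :
    (M - N) ^ 2 * (K ^ 2 - 4) ≤ 16 * ((M + N) * K + K ^ 2 + M * N) := by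
  rw [abs_le] at hM hN
  obtain ⟨S, hS⟩ : ∃ S, S = M + N := ⟨_, rfl⟩
  obtain ⟨Q, hQ⟩ : ∃ Q, Q = M * N + 4 := ⟨_, rfl⟩
  have h1 : 2 * S ≤ Q := by nlinarith
  have h2 : -(2 * S) ≤ Q := by nlinarith
  suffices h : S ^ 2 * (K ^ 2 - 4) - 16 * (S * K) ≤ 4 * K ^ 2 * Q by
    rw [hS, hQ] at h
    linarith
  have hK2 : 0 < K ^ 2 := by positivity
  rcases le_total 0 S with h0 | h0
  · have h4 : S ≤ 4 := by linarith
    have : S ^ 2 * (K ^ 2 - 4) ≤ 4 * S * K ^ 2 := by nlinarith [mul_nonneg h0 hK2.le]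
    nlinarith [mul_nonneg h0 (by linarith : 0 ≤ K), mul_nonneg h0 hK2.le]
  · obtain ⟨s, rfl⟩ : ∃ s, S = -(2 * s) := ⟨-S / 2, by ring⟩
    have hs : 0 ≤ s := by linarith
    have hs2 : s ≤ 2 := by linarith
    have h5 : s * (K + 2) ≤ 4 * K := by nlinarith
    have h6 := mul_nonneg (mul_nonneg hs (by linarith : 0 ≤ K - 2))
      (by linarith : 0 ≤ 4 * K - s * (K + 2))
    nlinarith

/-- The inequality behind `eta_nonpos`, with `s = -(M + N) / 2`, `P = M N` and `W = β - 2`. The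
difference of the two sides is concave in `P`, so it is bounded below by its values at the ends of
`4 s - 4 ≤ P ≤ s²`, an interval of length `(2 - s)²`. -/
theorem eta_aux_nonneg {s P W : ℝ} (hs : 0 ≤ s) (hs2 : s ≤ 2) (hW : 4 ≤ W)
    (h1 : 4 * s - 4 ≤ P) (h2 : P ≤ s ^ 2) :
    (s ^ 2 - P) * (W - P) * W + (W + 4) * s * (2 * W + 4 - P) ≤ 4 * W * (W + 4) := by
  rcases hs2.eq_or_lt with rfl | hlt
  · have : P = 4 := by linarith
    subst this
    nlinarith
  · have hp : 0 < (2 - s) ^ 2 := by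
      have : 0 < 2 - s := by linarith
      positivity
    have e : (2 - s) ^ 2 * (4 * W * (W + 4)
        - ((s ^ 2 - P) * (W - P) * W + (W + 4) * s * (2 * W + 4 - P)))
        = (2 - s) ^ 2 * (W * (P - (4 * s - 4)) * (s ^ 2 - P))
          + (s ^ 2 - P) * (s * (2 - s) * ((W + 4) * (W - 4) + 4 * W * (2 - s)))
          + (P - (4 * s - 4)) * ((W + 4) * (2 - s) * (2 * W - s * (2 + s))) := by ring
    have g1 : 0 ≤ P - (4 * s - 4) := by linarith
    have g2 : 0 ≤ s ^ 2 - P := by linarith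
    have g3 : 0 ≤ 2 - s := by linarith
    have g4 : 0 ≤ W - 4 := by linarith
    have g5 : 0 ≤ W := by linarith
    have g6 : 0 ≤ 2 * W - s * (2 + s) := by nlinarith
    have : 0 ≤ (2 - s) ^ 2 * (4 * W * (W + 4)
        - ((s ^ 2 - P) * (W - P) * W + (W + 4) * s * (2 * W + 4 - P))) := by
      rw [e]
      positivity
    linarith [nonneg_of_mul_nonneg_right this hp]

/-- `η ≤ 0`, multiplied by `w = √(β - 2)`, when each factor has no real root or a double one. -/
theorem eta_nonpos {M N K w : ℝ} (hK : 2 ≤ K) (hw : 2 ≤ w) (hwK : w ^ 2 = K ^ 2 - 4 + M * N)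
    (hM : |M| ≤ 2) (hN : |N| ≤ 2) :
    (M - N) ^ 2 * (K ^ 2 - 4) * w ≤ 4 * (w ^ 2 + 4) * ((M + N) * K + 4 * w) := by
  rw [abs_le] at hM hN
  have hW : 4 ≤ w ^ 2 := by nlinarith
  rcases le_total 0 (M + N) with h0 | h0
  · have h1 : (M - N) ^ 2 ≤ 16 := by nlinarith
    have h2 : K ^ 2 - 4 ≤ w ^ 2 + 4 := by nlinarith
    have h3 : (M - N) ^ 2 * (K ^ 2 - 4) ≤ 16 * (w ^ 2 + 4) :=
      mul_le_mul h1 h2 (by nlinarith) (by norm_num)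
    have h4 : 0 ≤ (w ^ 2 + 4) * ((M + N) * K) := by positivity
    nlinarith
  · obtain ⟨s, hs⟩ : ∃ s, M + N = -(2 * s) := ⟨-(M + N) / 2, by ring⟩
    have hF := eta_aux_nonneg (s := s) (P := M * N) (W := w ^ 2) (by linarith) (by linarith) hW
      (by nlinarith) (by nlinarith [sq_nonneg (M - N)])
    have hMN : (M - N) ^ 2 = 4 * (s ^ 2 - M * N) := by
      linear_combination (M + N - 2 * s) * hs
    -- `K` is the square root of `w² + 4 - M N`; the bound `2 w K ≤ w² + K²` removes it.
    have hamgm : 2 * (w * K) ≤ 2 * w ^ 2 + 4 - M * N := by nlinarith [sq_nonneg (w - K)]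
    have hs0 : 0 ≤ (w ^ 2 + 4) * s := mul_nonneg (by positivity) (by linarith)
    have h5 := mul_le_mul_of_nonneg_left hamgm hs0
    rw [hMN, hs, show K ^ 2 - 4 = w ^ 2 - M * N by linarith]
    refine le_of_mul_le_mul_right ?_ (by linarith : 0 < w)
    nlinarith

/-- `η > 0` when all four roots of the quartic are positive, unless the two factors coincide. -/
theorem eta_pos_of_both_neg {M N K w : ℝ} (hK : 2 ≤ K) (hw : 2 ≤ w)
    (hwK : w ^ 2 = K ^ 2 - 4 + M * N) (hM : M < -2) (hN : N ≤ -2) (hne : ¬ (M = N ∧ K = 2)) :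
    4 * (w ^ 2 + 4) * ((M + N) * K + 4 * w) < (M - N) ^ 2 * (K ^ 2 - 4) * w := by
  have hP : 4 < M * N := by nlinarith
  have hK4 : 0 ≤ K ^ 2 - 4 := by nlinarith
  have hsum : 0 ≤ -(M + N) * K := mul_nonneg (by linarith) (by linarith)
  have e : (-(M + N) * K) ^ 2 - (4 * w) ^ 2
      = (M - N) ^ 2 * K ^ 2 + 4 * ((M * N - 4) * (K ^ 2 - 4)) := by
    linear_combination -16 * hwK
  have hnn : 0 ≤ (M - N) ^ 2 * (K ^ 2 - 4) * w := by positivity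
  suffices h : 4 * w < -(M + N) * K by
    have : 4 * (w ^ 2 + 4) * ((M + N) * K + 4 * w) < 0 :=
      mul_neg_of_pos_of_neg (by positivity) (by linarith)
    linarith
  refine lt_of_pow_lt_pow_left₀ 2 hsum ?_
  have h1 : 0 ≤ (M * N - 4) * (K ^ 2 - 4) := mul_nonneg (by linarith) hK4
  rcases eq_or_ne M N with rfl | hMN
  · have hK2 : 2 < K := lt_of_le_of_ne hK (fun h => hne ⟨rfl, h.symm⟩)
    have : 0 < (M * M - 4) * (K ^ 2 - 4) := mul_pos (by linarith) (by nlinarith)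
    nlinarith
  · have : 0 < (M - N) ^ 2 * K ^ 2 := by
      have := sub_ne_zero.2 hMN
      positivity
    linarith

/-- `μ > 0` when the quartic has two simple positive and two negative roots. -/
theorem mu_pos {M N K : ℝ} (hK : 2 ≤ K) (hM : M < -2) (hN : 2 ≤ N) :
    16 * ((M + N) * K + K ^ 2 + M * N) < (M - N) ^ 2 * (K ^ 2 - 4) := by
  obtain ⟨S, hS⟩ : ∃ S, S = M + N := ⟨_, rfl⟩
  obtain ⟨Q, hQ⟩ : ∃ Q, Q = -(M * N + 4) := ⟨_, rfl⟩
  have h1 : -(2 * S) ≤ Q := by nlinarith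
  have h2 : 2 * S < Q := by nlinarith
  suffices h : 0 < S ^ 2 * (K ^ 2 - 4) - 16 * (S * K) + 4 * K ^ 2 * Q by
    rw [hS, hQ] at h
    linarith
  have hK2 : 0 < K ^ 2 := by positivity
  have hK4 : 0 ≤ K ^ 2 - 4 := by nlinarith
  have h3 : 0 ≤ S ^ 2 * (K ^ 2 - 4) := by positivity
  rcases le_or_gt 0 S with h0 | h0
  · have h5 : 4 * K ^ 2 * (2 * S) < 4 * K ^ 2 * Q := mul_lt_mul_of_pos_left h2 (by positivity)
    have h6 : 0 ≤ S * (K * (K - 2)) :=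
      mul_nonneg h0 (mul_nonneg (by linarith) (by linarith))
    nlinarith
  · have h5 : 0 < -S * K := mul_pos (by linarith) (by linarith)
    have h6 : 0 < K ^ 2 * Q := mul_pos hK2 (by linarith)
    linarith

/-- `η > 0` when the quartic has two simple positive and two negative roots. -/
theorem eta_pos_of_opposite {M N K w : ℝ} (hK : 2 ≤ K) (hw : 2 ≤ w)
    (hwK : w ^ 2 = K ^ 2 - 4 + M * N) (hM : M < -2) (hN : 2 ≤ N) :
    4 * (w ^ 2 + 4) * ((M + N) * K + 4 * w) < (M - N) ^ 2 * (K ^ 2 - 4) * w := by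
  obtain ⟨r, hr⟩ : ∃ r, M + N = 2 * r := ⟨(M + N) / 2, by ring⟩
  obtain ⟨T, hT⟩ : ∃ T, T = -(M * N) := ⟨_, rfl⟩
  obtain ⟨W, hWdef⟩ : ∃ W, W = w ^ 2 := ⟨_, rfl⟩
  have hW : 4 ≤ W := by nlinarith
  have h1 : 4 + 4 * r < T := by nlinarith
  have h2 : 4 - 4 * r ≤ T := by nlinarith
  have hMN : (M - N) ^ 2 = 4 * (r ^ 2 + T) := by
    rw [hT]
    linear_combination (M + N + 2 * r) * hr
  have hKT : K ^ 2 - 4 = W + T := by rw [hT, hWdef]; linarith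
  rw [hMN, hr, hKT, ← hWdef]
  rcases le_or_gt 0 r with h0 | h0
  · have hamgm : 2 * (w * K) ≤ 2 * W + 4 + T := by nlinarith [sq_nonneg (w - K)]
    have h5 := mul_le_mul_of_nonneg_left hamgm
      (mul_nonneg (by linarith : 0 ≤ W + 4) h0)
    refine lt_of_mul_lt_mul_right ?_ (by linarith : 0 ≤ w)
    have hH : (W + 4) * (4 * W + r * (2 * W + 4 + T)) < (r ^ 2 + T) * (W + T) * W := by
      obtain ⟨y, rfl⟩ : ∃ y, T = 4 + 4 * r + y := ⟨T - (4 + 4 * r), by ring⟩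
      obtain ⟨v, rfl⟩ : ∃ v, W = 4 + v := ⟨W - 4, by ring⟩
      have hy : 0 < y := by linarith
      have hv : 0 ≤ v := by linarith
      rw [← sub_pos]
      ring_nf
      positivity
    have e1 : 4 * (W + 4) * (2 * r * K + 4 * w) * w
        = 4 * ((W + 4) * r * (2 * (w * K)) + 4 * (W + 4) * W) := by rw [hWdef]; ring
    have e2 : 4 * (r ^ 2 + T) * (W + T) * w * w = 4 * ((r ^ 2 + T) * (W + T) * W) := by
      rw [hWdef]; ring
    nlinarith
  · have h5 : r * K < 0 := mul_neg_of_neg_of_pos h0 (by linarith)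
    have h6 : 4 * (W + 4) ≤ (r ^ 2 + T) * (W + T) :=
      mul_le_mul (by nlinarith) (by linarith) (by linarith) (by nlinarith)
    have h7 := mul_le_mul_of_nonneg_right h6 (by linarith : 0 ≤ w)
    have h8 : (W + 4) * (r * K) < 0 := mul_neg_of_pos_of_neg (by linarith) h5
    nlinarith

/-! ### The Ulrich–Watson criterion -/

theorem sub_div_mul_nonpos_iff {d b c w : ℝ} (hw : 0 < w) :
    d - 4 * b / w * c ≤ 0 ↔ d * w ≤ 4 * b * c := by
  rw [sub_nonpos, div_mul_eq_mul_div, le_div_iff₀ hw]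

/-- The alternative `Δ ≤ 0`, `α + γ > 0` is available for every value of `β`. -/
theorem UWMonic.of_discriminant_nonpos {α β γ : ℝ}
    (hΔ : 4 * (β ^ 2 - 3 * α * γ + 12) ^ 3
      - (72 * β + 9 * α * β * γ - 2 * β ^ 3 - 27 * α ^ 2 - 27 * γ ^ 2) ^ 2 ≤ 0)
    (h : 0 < α + γ) : UWMonic α β γ := by
  rcases lt_or_ge β (-2) with h1 | h1
  · exact Or.inl ⟨h1, hΔ, h⟩
  rcases le_or_gt β 6 with h2 | h2
  · exact Or.inr (Or.inl ⟨⟨h1, h2⟩, Or.inl ⟨hΔ, h⟩⟩)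
  · exact Or.inr (Or.inr ⟨h2, Or.inl ⟨hΔ, h⟩⟩)

/-- The two quadratic factors have no common root if the first has simple positive roots and the
second has no positive root. For `|N| < 2`, four times the resultant is
`(2 K² - (4 + M N))² + (M² - 4) (4 - N²)`. -/
theorem resultant_pos {M N K : ℝ} (hK : 2 ≤ K) (hM : M < -2) (hN : -2 < N) :
    0 < (K ^ 2 - 4) * (K ^ 2 - M * N) + (M - N) ^ 2 := by
  rcases lt_or_ge N 2 with h | h
  · have h1 : 0 < (M ^ 2 - 4) * (4 - N ^ 2) := mul_pos (by nlinarith) (by nlinarith)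
    nlinarith [sq_nonneg (2 * K ^ 2 - (4 + M * N))]
  · have h1 : 0 ≤ (K ^ 2 - 4) * (K ^ 2 - M * N) := mul_nonneg (by nlinarith) (by nlinarith)
    have h2 : 0 < (M - N) ^ 2 := sq_pos_of_neg (by linarith)
    linarith

section
variable {κ l M N α β γ : ℝ}

theorem two_le_add_of_mul_eq_one (hκ : 0 < κ) (hl : 0 < l) (h : κ * l = 1) : 2 ≤ κ + l := by
  nlinarith [sq_nonneg (κ - l)]

/-- The criterion fails for a quartic that changes sign on `(0, ∞)`. -/
theorem not_uwMonic_of_lt_neg_two (hκ : 0 < κ) (hl : 0 < l) (h : κ * l = 1)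
    (hα : α = κ * M + l * N) (hβ : β = κ ^ 2 + l ^ 2 + M * N) (hγ : γ = l * M + κ * N)
    (hM : M < -2) (hne : ¬ (M = N ∧ κ = l)) : ¬ UWMonic α β γ := by
  have hK := two_le_add_of_mul_eq_one hκ hl h
  have hne' : ¬ (M = N ∧ κ + l = 2) := by
    rintro ⟨h1, h2⟩
    refine hne ⟨h1, ?_⟩
    have : (κ - l) ^ 2 = 0 := by
      linear_combination (κ + l + 2) * h2 - 4 * h
    linarith [pow_eq_zero_iff two_ne_zero |>.1 this]
  have hΔ := discriminant_eq h M N hα hβ hγ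
  obtain ⟨R, hR⟩ : ∃ R, R = ((κ + l) ^ 2 - 4) * ((κ + l) ^ 2 - M * N) + (M - N) ^ 2 := ⟨_, rfl⟩
  rw [← hR] at hΔ
  have hsum : α + γ = (M + N) * (κ + l) := by rw [hα, hγ]; ring
  have hdiff : (α - γ) ^ 2 = (M - N) ^ 2 * ((κ + l) ^ 2 - 4) := by
    rw [hα, hγ]
    linear_combination -4 * (M - N) ^ 2 * h
  have hβK : β = (κ + l) ^ 2 - 2 + M * N := by
    rw [hβ]
    linear_combination -2 * h
  have hM4 : 0 < M ^ 2 - 4 := by nlinarith only [hM]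
  have neg_of_lt : N < 2 → α + γ < 0 := fun hN => by
    rw [hsum]
    exact mul_neg_of_neg_of_pos (by linarith) (by linarith)
  intro hU
  simp only [UWMonic] at hU
  rw [hΔ, hdiff, show α + β + γ + 2 = (α + γ) + β + 2 by ring, hsum] at hU
  -- A nonpositive discriminant with `α + γ > 0` requires `N > 2`, but then `Δ > 0`.
  have c1 : ¬ (27 * (M ^ 2 - 4) * (N ^ 2 - 4) * R ^ 2 ≤ 0 ∧
        0 < (M + N) * (κ + l)) := by
    rintro ⟨h1, h2⟩
    have hN : 2 < N := by
      have := pos_of_mul_pos_left h2 (by linarith)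
      linarith
    have hR0 : 0 < R := hR ▸ resultant_pos hK hM (by linarith : -2 < N)
    have : 0 < N ^ 2 - 4 := by nlinarith only [hN]
    refine h1.not_gt ?_
    positivity
  -- Positive coefficients exclude a sign change on `(0, ∞)`.
  have c2 : ¬ (6 < β ∧ 0 < α ∧ 0 < γ) := by
    rintro ⟨h1, h2, h3⟩
    refine hne (eq_of_mul_nonneg_of_lt_neg_two hκ hl hM fun t ht => ?_)
    rw [← factorization_identity h, ← hα, ← hβ, ← hγ]
    positivity
  -- For `|N| < 2` the quartic has exactly two real roots, both simple, and `Δ < 0`.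
  have c3 : 0 ≤ 27 * (M ^ 2 - 4) * (N ^ 2 - 4) * R ^ 2 → N ≤ -2 ∨ 2 ≤ N := by
    intro h1
    by_contra! h2
    have hR0 : 0 < R := hR ▸ resultant_pos hK hM h2.1
    have : 0 < 4 - N ^ 2 := by nlinarith only [h2.1, h2.2]
    have : 0 < 27 * (M ^ 2 - 4) * (4 - N ^ 2) * R ^ 2 := by positivity
    linarith
  rcases hU with ⟨-, h1⟩ | ⟨⟨-, h6⟩, h1 | ⟨h1, h2⟩⟩ | ⟨h6, h1 | h1 | ⟨h1, h2⟩⟩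
  · exact c1 h1
  · exact c1 h1
  · rcases c3 h1 with hN | hN
    · nlinarith only [hM, hN, hK, h6, hβK]
    · have := mu_pos hK hM hN
      linarith
  · exact c1 h1
  · exact c2 ⟨h6, h1⟩
  · have hw : 2 ≤ √(β - 2) := Real.le_sqrt_of_sq_le (by linarith)
    have hwK : √(β - 2) ^ 2 = (κ + l) ^ 2 - 4 + M * N := by
      rw [Real.sq_sqrt (by linarith)]
      linarith
    rw [sub_div_mul_nonpos_iff (by linarith), show β + 2 = √(β - 2) ^ 2 + 4 by linarith] at h2
    rcases c3 h1 with hN | hN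
    · exact h2.not_gt (eta_pos_of_both_neg hK hw hwK hM hN hne')
    · exact h2.not_gt (eta_pos_of_opposite hK hw hwK hM hN)

theorem uwMonic_of_abs_le_two (hκ : 0 < κ) (hl : 0 < l) (h : κ * l = 1)
    (hα : α = κ * M + l * N) (hβ : β = κ ^ 2 + l ^ 2 + M * N) (hγ : γ = l * M + κ * N)
    (hM : |M| ≤ 2) (hN : |N| ≤ 2) : UWMonic α β γ := by
  have hK := two_le_add_of_mul_eq_one hκ hl h
  have hΔ := discriminant_eq h M N hα hβ hγ
  obtain ⟨R, hR⟩ : ∃ R, R = ((κ + l) ^ 2 - 4) * ((κ + l) ^ 2 - M * N) + (M - N) ^ 2 := ⟨_, rfl⟩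
  rw [← hR] at hΔ
  have hsum : α + γ = (M + N) * (κ + l) := by rw [hα, hγ]; ring
  have hdiff : (α - γ) ^ 2 = (M - N) ^ 2 * ((κ + l) ^ 2 - 4) := by
    rw [hα, hγ]
    linear_combination -4 * (M - N) ^ 2 * h
  have hβK : β = (κ + l) ^ 2 - 2 + M * N := by
    rw [hβ]
    linear_combination -2 * h
  have hμ := mu_nonpos hK hM hN
  have hη := fun w hw hwK => eta_nonpos (w := w) hK hw hwK hM hN
  rw [abs_le] at hM hN
  have hΔ0 : 0 ≤ 27 * (M ^ 2 - 4) * (N ^ 2 - 4) * R ^ 2 := by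
    have h1 : 0 ≤ 4 - M ^ 2 := by nlinarith only [hM.1, hM.2]
    have h2 : 0 ≤ 4 - N ^ 2 := by nlinarith only [hN.1, hN.2]
    have : 0 ≤ 27 * (4 - M ^ 2) * (4 - N ^ 2) * R ^ 2 := by positivity
    linarith
  simp only [UWMonic]
  rw [hΔ, hdiff, show α + β + γ + 2 = (α + γ) + β + 2 by ring, hsum]
  rcases le_or_gt β 6 with h6 | h6
  · exact Or.inr (Or.inl ⟨⟨by nlinarith only [hK, hβK, hM.1, hM.2, hN.1, hN.2], h6⟩,
      Or.inr ⟨hΔ0, by linarith⟩⟩)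
  · refine Or.inr (Or.inr ⟨h6, Or.inr (Or.inr ⟨hΔ0, ?_⟩)⟩)
    have hw : 2 ≤ √(β - 2) := Real.le_sqrt_of_sq_le (by linarith)
    have hwK : √(β - 2) ^ 2 = (κ + l) ^ 2 - 4 + M * N := by
      rw [Real.sq_sqrt (by linarith)]
      linarith
    rw [sub_div_mul_nonpos_iff (by linarith), show β + 2 = √(β - 2) ^ 2 + 4 by linarith]
    exact hη _ hw hwK

/-- For `|N| ≤ 2` the criterion holds through its alternative `Δ ≤ 0`, `α + γ > 0`, and for `N > 2`
through positive coefficients. -/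
theorem uwMonic_of_two_lt (hκ : 0 < κ) (hl : 0 < l) (h : κ * l = 1)
    (hα : α = κ * M + l * N) (hβ : β = κ ^ 2 + l ^ 2 + M * N) (hγ : γ = l * M + κ * N)
    (hM : 2 < M) (hN : -2 ≤ N) : UWMonic α β γ := by
  have hΔ := discriminant_eq h M N hα hβ hγ
  obtain ⟨R, hR⟩ : ∃ R, R = ((κ + l) ^ 2 - 4) * ((κ + l) ^ 2 - M * N) + (M - N) ^ 2 := ⟨_, rfl⟩
  rw [← hR] at hΔ
  have hsum : α + γ = (M + N) * (κ + l) := by rw [hα, hγ]; ring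
  have hM4 : 0 < M ^ 2 - 4 := by nlinarith only [hM]
  rcases le_or_gt N 2 with h2 | h2
  · refine UWMonic.of_discriminant_nonpos ?_ ?_
    · have h4 : 0 ≤ 4 - N ^ 2 := by nlinarith only [hN, h2]
      have : 0 ≤ 27 * (M ^ 2 - 4) * (4 - N ^ 2) * R ^ 2 := by positivity
      rw [hΔ]
      linarith
    · rw [hsum]
      exact mul_pos (by linarith) (by linarith)
  · have hM0 : 0 < M := by linarith
    have hN0 : 0 < N := by linarith
    refine Or.inr (Or.inr ⟨?_, Or.inr (Or.inl ⟨?_, ?_⟩)⟩)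
    · nlinarith only [sq_nonneg (κ - l), h, hβ, mul_pos (sub_pos.2 hM) (sub_pos.2 h2), hM, h2]
    · rw [hα]
      positivity
    · rw [hγ]
      positivity

/-- The criterion holds for the square of a quadratic `t² + M t + 1` with two positive roots: there
`Δ = 0` and `η = 0`. -/
theorem uwMonic_of_sq (hα : α = 2 * M) (hβ : β = 2 + M ^ 2) (hγ : γ = 2 * M) (hM : M < -2) :
    UWMonic α β γ := by
  have hΔ := discriminant_eq (one_mul 1) M M (α := α) (β := β) (γ := γ)
    (by rw [hα]; ring) (by rw [hβ]; ring) (by rw [hγ]; ring)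
  have hw : √(β - 2) = -M := by
    rw [hβ, show 2 + M ^ 2 - 2 = (-M) ^ 2 by ring, Real.sqrt_sq (by linarith)]
  refine Or.inr (Or.inr ⟨by nlinarith, Or.inr (Or.inr ⟨?_, ?_⟩)⟩)
  · rw [hΔ]
    norm_num
  · rw [hw, hα, hγ]
    exact le_of_eq (by ring)

theorem uwMonic_iff_of_factorization (hκ : 0 < κ) (hl : 0 < l) (h : κ * l = 1)
    (hα : α = κ * M + l * N) (hβ : β = κ ^ 2 + l ^ 2 + M * N) (hγ : γ = l * M + κ * N) :
    UWMonic α β γ ↔ (-2 ≤ M ∧ -2 ≤ N) ∨ (M = N ∧ κ = l) := by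
  have h' : l * κ = 1 := by rw [mul_comm, h]
  have hα' : α = l * N + κ * M := by rw [hα]; ring
  have hβ' : β = l ^ 2 + κ ^ 2 + N * M := by rw [hβ]; ring
  have hγ' : γ = κ * N + l * M := by rw [hγ]; ring
  constructor
  · intro hU
    by_contra! hcon
    rcases lt_or_ge M (-2) with hM | hM
    · exact not_uwMonic_of_lt_neg_two hκ hl h hα hβ hγ hM (fun hc => hcon.2 hc.1 hc.2) hU
    · exact not_uwMonic_of_lt_neg_two hl hκ h' hα' hβ' hγ' (hcon.1 hM)
        (fun hc => hcon.2 hc.1.symm hc.2.symm) hU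
  · intro hMN
    rcases lt_or_ge M (-2) with hM | hM
    · rcases hMN with hMN | ⟨rfl, rfl⟩
      · linarith [hMN.1]
      · obtain rfl : κ = 1 := by nlinarith
        exact uwMonic_of_sq (by rw [hα]; ring) (by rw [hβ]; ring) (by rw [hγ]; ring) hM
    · have hN : -2 ≤ N := by
        rcases hMN with hMN | ⟨rfl, -⟩
        · exact hMN.2
        · exact hM
      rcases lt_or_ge 2 M with hM2 | hM2
      · exact uwMonic_of_two_lt hκ hl h hα hβ hγ hM2 hN
      rcases lt_or_ge 2 N with hN2 | hN2
      · exact uwMonic_of_two_lt hl hκ h' hα' hβ' hγ' hN2 hM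
      · exact uwMonic_of_abs_le_two hκ hl h hα hβ hγ (abs_le.2 ⟨hM, hM2⟩) (abs_le.2 ⟨hN, hN2⟩)

end

theorem uwMonic_iff (α β γ : ℝ) :
    UWMonic α β γ ↔ ∀ t : ℝ, 0 < t → 0 ≤ t ^ 4 + α * t ^ 3 + β * t ^ 2 + γ * t + 1 := by
  obtain ⟨κ, l, M, N, hκ, hl, h, hα, hβ, hγ⟩ := exists_factorization α β γ
  rw [uwMonic_iff_of_factorization hκ hl h hα hβ hγ, ← mul_nonneg_iff hκ hl, hα, hβ, hγ]
  simp only [factorization_identity h]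

/-- The Ulrich–Watson criterion decides nonnegativity on `(0, ∞)`. With `a = x⁴` and `e = y⁴`, the
substitution `t = (y / x) u` and division by `y⁴` normalize the quartic. -/
theorem ulrichWatson_iff {a b c d e : ℝ} (ha : 0 < a) (he : 0 < e) :
    UlrichWatson a b c d e ↔
      ∀ t : ℝ, 0 < t → 0 ≤ a * t ^ 4 + b * t ^ 3 + c * t ^ 2 + d * t + e := by
  obtain ⟨x, hx, rfl⟩ : ∃ x : ℝ, 0 < x ∧ x ^ 4 = a :=
    ⟨a ^ (1 / 4 : ℝ), by positivity, by rw [← Real.rpow_natCast, ← Real.rpow_mul ha.le]; norm_num⟩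
  obtain ⟨y, hy, rfl⟩ : ∃ y : ℝ, 0 < y ∧ y ^ 4 = e :=
    ⟨e ^ (1 / 4 : ℝ), by positivity, by rw [← Real.rpow_natCast, ← Real.rpow_mul he.le]; norm_num⟩
  have key : ∀ z : ℝ, 0 < z → (z ^ 4) ^ (-(3 / 4) : ℝ) = (z ^ 3)⁻¹ ∧
      (z ^ 4) ^ (-(1 / 2) : ℝ) = (z ^ 2)⁻¹ ∧ (z ^ 4) ^ (-(1 / 4) : ℝ) = z⁻¹ := by
    intro z hz
    have hpow : ∀ n : ℕ, ∀ s : ℝ, s = -(n / 4) → (z ^ 4) ^ s = (z ^ n)⁻¹ := by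
      rintro n s rfl
      rw [← Real.rpow_natCast z 4, ← Real.rpow_mul hz.le, ← Real.rpow_natCast z n,
        ← Real.rpow_neg hz.le]
      congr 1
      push_cast
      ring
    exact ⟨hpow 3 _ (by norm_num), hpow 2 _ (by norm_num),
      by simpa using hpow 1 (-(1 / 4)) (by norm_num)⟩
  have hU : UlrichWatson (x ^ 4) b c d (y ^ 4) ↔
      UWMonic (b * (x ^ 3)⁻¹ * y⁻¹) (c * (x ^ 2)⁻¹ * (y ^ 2)⁻¹) (d * x⁻¹ * (y ^ 3)⁻¹) := by
    rw [← (key x hx).1, ← (key x hx).2.1, ← (key x hx).2.2, ← (key y hy).1, ← (key y hy).2.1,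
      ← (key y hy).2.2]
    exact ⟨fun h => h.2.2, fun h => ⟨ha, he, h⟩⟩
  rw [hU, uwMonic_iff]
  constructor
  · intro h t ht
    have := mul_nonneg he.le (h (x * t / y) (by positivity))
    exact this.trans_eq (by field_simp)
  · intro h u hu
    have := mul_nonneg (inv_pos.2 he).le (h (y * u / x) (by positivity))
    exact this.trans_eq (by field_simp)

/-! ### Quartic polynomials, shifted and inverted -/

theorem eval_eq_of_natDegree_le_four {q : ℝ[X]} (hq : q.natDegree ≤ 4) (t : ℝ) :
    q.eval t = q.coeff 4 * t ^ 4 + q.coeff 3 * t ^ 3 + q.coeff 2 * t ^ 2 + q.coeff 1 * t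
      + q.coeff 0 := by
  rw [eval_eq_sum_range' (Nat.lt_succ_of_le hq)]
  simp only [Finset.sum_range_succ, Finset.sum_range_zero]
  ring

theorem eval_nonneg_of_satisfiesUW {q : ℝ[X]} (hq : q.natDegree ≤ 4) (h : SatisfiesUW q)
    {t : ℝ} (ht : 0 < t) : 0 ≤ q.eval t := by
  rw [eval_eq_of_natDegree_le_four hq]
  exact (ulrichWatson_iff h.1 h.2.1).1 h t ht

/-- The constant coefficient is the limit of the values at `0⁺`. -/
theorem coeff_zero_nonneg {q : ℝ[X]} (h : ∀ t : ℝ, 0 < t → 0 ≤ q.eval t) : 0 ≤ q.coeff 0 := by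
  rw [coeff_zero_eq_eval_zero]
  have hc : Filter.Tendsto (fun t => q.eval t) (nhdsWithin 0 (Set.Ioi 0)) (nhds (q.eval 0)) :=
    q.continuous.continuousAt.tendsto.mono_left nhdsWithin_le_nhds
  exact ge_of_tendsto hc (by filter_upwards [self_mem_nhdsWithin] with t ht using h t ht)

theorem natDegree_shift_le {q : ℝ[X]} (hq : q.natDegree ≤ 4) (r : ℝ) :
    (shift q r).natDegree ≤ 4 := by
  rwa [shift, natDegree_comp, natDegree_X_add_C, mul_one]

theorem natDegree_invert_le {q : ℝ[X]} (hq : q.natDegree ≤ 4) (r : ℝ) :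
    (invert q r).natDegree ≤ 4 :=
  natDegree_reflect_le.trans (max_le le_rfl (natDegree_shift_le hq r))

/-- The coefficient of degree four is the constant coefficient of `u⁴ q(1/u)`. -/
theorem coeff_four_nonneg {q : ℝ[X]} (hq : q.natDegree ≤ 4)
    (h : ∀ t : ℝ, 0 < t → 0 ≤ q.eval t) : 0 ≤ q.coeff 4 := by
  have hi : (invert q 0).coeff 0 = q.coeff 4 := by
    simp [invert, shift, coeff_reflect, revAt_le]
  rw [← hi]
  refine coeff_zero_nonneg fun t ht => ?_
  rw [eval_invert q hq 0 t ht.ne', add_zero]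
  exact mul_nonneg (by positivity) (h _ (by positivity))

theorem satisfiesUW_of_eval_nonneg {q : ℝ[X]} (hq : q.natDegree ≤ 4) (hne : NonzeroEnds q)
    (h : ∀ t : ℝ, 0 < t → 0 ≤ q.eval t) : SatisfiesUW q := by
  have h4 := lt_of_le_of_ne (coeff_four_nonneg hq h) hne.1.symm
  have h0 := lt_of_le_of_ne (coeff_zero_nonneg h) hne.2.symm
  refine (ulrichWatson_iff h4 h0).2 fun t ht => ?_
  rw [← eval_eq_of_natDegree_le_four hq]
  exact h t ht

theorem forall_eval_shift_nonneg_iff (q : ℝ[X]) (r : ℝ) :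
    (∀ u : ℝ, 0 < u → 0 ≤ (shift q r).eval u) ↔ ∀ t : ℝ, r < t → 0 ≤ q.eval t := by
  simp only [eval_shift]
  constructor
  · intro h t ht
    simpa using h (t - r) (by linarith)
  · intro h u hu
    exact h _ (by linarith)

/-- The map `u ↦ r + 1 / (u + 1 / (s - r))` carries `(0, ∞)` onto `(r, s)`. -/
theorem forall_eval_shift_invert_nonneg_iff {q : ℝ[X]} (hq : q.natDegree ≤ 4) {r s : ℝ}
    (hrs : r < s) :
    (∀ u : ℝ, 0 < u → 0 ≤ (shift (invert q r) (1 / (s - r))).eval u) ↔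
      ∀ t : ℝ, r < t → t < s → 0 ≤ q.eval t := by
  rw [forall_eval_shift_nonneg_iff]
  have hpos : 0 < 1 / (s - r) := one_div_pos.2 (by linarith)
  constructor
  · intro h t hrt hts
    have ht : 0 < t - r := by linarith
    have h1 := h (1 / (t - r)) (one_div_lt_one_div_of_lt ht (by linarith))
    rw [eval_invert q hq r _ (one_div_pos.2 ht).ne', one_div_one_div, sub_add_cancel] at h1
    exact nonneg_of_mul_nonneg_right h1 (by positivity)
  · intro h v hv
    have hv0 : 0 < v := hpos.trans hv
    rw [eval_invert q hq r v hv0.ne']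
    refine mul_nonneg (by positivity) (h _ ?_ ?_)
    · linarith [one_div_pos.2 hv0]
    · have := one_div_lt_one_div_of_lt hpos hv
      rw [one_div_one_div] at this
      linarith

theorem eval_nonneg_of_forall_gt {q : ℝ[X]} {r : ℝ} (h : ∀ t : ℝ, r < t → 0 ≤ q.eval t) :
    0 ≤ q.eval r := by
  have := coeff_zero_nonneg ((forall_eval_shift_nonneg_iff q r).2 h)
  rwa [coeff_zero_eq_eval_zero, eval_shift, zero_add] at this

/-! ### Reduction of the potential to the quartic `g` -/

/-- Copositivity of a quadratic form in `(x², y²)` bounds its mixed coefficient from below. -/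
theorem neg_two_mul_sqrt_le {a b c : ℝ} (ha : 0 ≤ a) (hc : 0 ≤ c)
    (h : ∀ x y : ℝ, 0 ≤ x → 0 ≤ y → 0 ≤ a * x ^ 4 + b * x ^ 2 * y ^ 2 + c * y ^ 4) :
    -2 * √(a * c) ≤ b := by
  have key : ∀ u v : ℝ, 0 ≤ u → 0 ≤ v → 0 ≤ a * u ^ 2 + b * u * v + c * v ^ 2 := by
    intro u v hu hv
    have h1 := h (√u) (√v) (Real.sqrt_nonneg _) (Real.sqrt_nonneg _)
    have hp : ∀ z : ℝ, 0 ≤ z → √z ^ 4 = z ^ 2 := fun z hz => by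
      rw [show √z ^ 4 = (√z ^ 2) ^ 2 by ring, Real.sq_sqrt hz]
    rwa [hp u hu, hp v hv, Real.sq_sqrt hu, Real.sq_sqrt hv] at h1
  rcases le_or_gt 0 b with hb | hb
  · linarith [Real.sqrt_nonneg (a * c)]
  have h4 : b ^ 2 ≤ 4 * (a * c) := by
    rcases ha.eq_or_lt with rfl | ha'
    -- For `a = 0` the form takes the value `-1` at `((c + 1) / (-b), 1)`.
    · have := key ((c + 1) / (-b)) 1 (div_nonneg (by linarith) (by linarith)) zero_le_one
      have e : 0 * ((c + 1) / -b) ^ 2 + b * ((c + 1) / -b) * 1 + c * 1 ^ 2 = -1 := by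
        have := hb.ne
        field_simp
        ring
      linarith
    -- `(-b, 2 a)` is the direction of the minimum of the form.
    · have := key (-b) (2 * a) (by linarith) (by linarith)
      nlinarith
  have h5 : |b| ≤ √(4 * (a * c)) := Real.abs_le_sqrt h4
  rw [Real.sqrt_mul (by norm_num), show (4 : ℝ) = 2 ^ 2 by norm_num,
    Real.sqrt_sq (by norm_num)] at h5
  linarith [neg_abs_le b]

theorem quadratic_nonneg_of_neg_two_mul_sqrt_le {a b c : ℝ} (ha : 0 ≤ a) (hc : 0 ≤ c)
    (h : -2 * √(a * c) ≤ b) {u v : ℝ} (hu : 0 ≤ u) (hv : 0 ≤ v) :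
    0 ≤ a * u ^ 2 + b * u * v + c * v ^ 2 := by
  rw [Real.sqrt_mul ha] at h
  have h1 := Real.sq_sqrt ha
  have h2 := Real.sq_sqrt hc
  have h3 := mul_le_mul_of_nonneg_right h (mul_nonneg hu hv)
  nlinarith [sq_nonneg (√a * u - √c * v)]

theorem mul_sub_mul_sub_neg_iff {p x y t : ℝ} (hp : 0 < p) (hxy : x ≤ y) :
    p * ((t - x) * (t - y)) < 0 ↔ x < t ∧ t < y := by
  rw [← neg_pos, ← mul_neg, mul_pos_iff_of_pos_left hp]
  constructor
  · intro h
    constructor <;> nlinarith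
  · rintro ⟨h1, h2⟩
    nlinarith

namespace Params

variable {P : Params}

/-- The potential as a quadratic in `s²`: since only nonnegative values of `s²` count, the
discriminant condition is needed only where the linear coefficient `α` is negative. -/
theorem forall_potential_nonneg_iff (h0 : 0 ≤ P.lamS) {x y : ℝ} (hβ : 0 ≤ P.beta x y) :
    (∀ s : ℝ, 0 ≤ s → 0 ≤ P.potential x y s) ↔
      (P.alpha x y < 0 → P.alpha x y ^ 2 ≤ 4 * P.lamS * P.beta x y) := by
  simp only [potential_eq]
  constructor
  · intro h hα
    rcases h0.eq_or_lt with hS | hS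
    -- For `λ_S = 0` and `α < 0` the potential is `-1` at `s² = (β + 1) / (-α)`.
    · exfalso
      have hu : 0 ≤ (P.beta x y + 1) / -P.alpha x y := div_nonneg (by linarith) (by linarith)
      have := h √((P.beta x y + 1) / -P.alpha x y) (Real.sqrt_nonneg _)
      rw [Real.sq_sqrt hu, ← hS] at this
      have e : P.alpha x y * ((P.beta x y + 1) / -P.alpha x y) = -(P.beta x y + 1) := by
        have := hα.ne
        field_simp
      linarith
    · have hu : 0 ≤ -P.alpha x y / (2 * P.lamS) := div_nonneg (by linarith) (by linarith)
      have := h √(-P.alpha x y / (2 * P.lamS)) (Real.sqrt_nonneg _)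
      rw [show √(-P.alpha x y / (2 * P.lamS)) ^ 4 = (√(-P.alpha x y / (2 * P.lamS)) ^ 2) ^ 2
        by ring, Real.sq_sqrt hu] at this
      have h2 := mul_nonneg (by linarith : 0 ≤ 4 * P.lamS) this
      have e : 4 * P.lamS * (P.lamS * (-P.alpha x y / (2 * P.lamS)) ^ 2 +
          P.alpha x y * (-P.alpha x y / (2 * P.lamS)) + P.beta x y)
          = 4 * P.lamS * P.beta x y - P.alpha x y ^ 2 := by
        field_simp
        ring
      linarith
  · intro h s _
    rcases le_or_gt 0 (P.alpha x y) with hα | hα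
    · positivity
    · rcases h0.eq_or_lt with hS | hS
      · have := h hα
        rw [← hS] at this
        nlinarith
      · refine nonneg_of_mul_nonneg_right (a := 4 * P.lamS) ?_ (by linarith)
        nlinarith [sq_nonneg (2 * P.lamS * s ^ 2 + P.alpha x y), h hα]

theorem potential_homogeneous (c x y s : ℝ) :
    P.potential (c * x) (c * y) (c * s) = c ^ 4 * P.potential x y s := by
  unfold potential
  ring

theorem beta_nonneg (h : P.Condition1) (x y : ℝ) : 0 ≤ P.beta x y := by
  obtain ⟨-, h1, h2, h3, -, -⟩ := h
  have := quadratic_nonneg_of_neg_two_mul_sqrt_le h1 h2 h3 (sq_nonneg x) (sq_nonneg y)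
  unfold beta
  nlinarith

/-- The boundary faces `h₁ = 0` and `h₂ = 0` are covered by the explicit inequalities; elsewhere
the potential is rescaled to `h₁ = 1`. -/
theorem potentialNonneg_iff (h : P.Condition1) :
    P.PotentialNonneg ↔ ∀ t : ℝ, 0 < t → P.alpha 1 t < 0 → 0 ≤ P.g.eval t := by
  have hS := h.1
  constructor
  · intro hP t ht hα
    rw [eval_g, sub_nonneg]
    exact (forall_potential_nonneg_iff hS (beta_nonneg h 1 t)).1
      (fun s hs => hP 1 t s zero_le_one ht.le hs) hα
  · intro hg x y s hx hy hs
    have hβ := beta_nonneg h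
    obtain ⟨hS, h1, h2, -, hS1, hS2⟩ := h
    rcases hx.eq_or_lt with rfl | hx
    · have := quadratic_nonneg_of_neg_two_mul_sqrt_le hS h2 hS2 (sq_nonneg s) (sq_nonneg y)
      unfold potential
      nlinarith
    rcases hy.eq_or_lt with rfl | hy
    · have := quadratic_nonneg_of_neg_two_mul_sqrt_le hS h1 hS1 (sq_nonneg s) (sq_nonneg x)
      unfold potential
      nlinarith
    have hxy : 0 < y / x := div_pos hy hx
    have := (forall_potential_nonneg_iff hS (hβ 1 (y / x))).2
      (fun hα => by
        have := hg _ hxy hα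
        rwa [eval_g, sub_nonneg] at this) (s / x) (by positivity)
    have e := P.potential_homogeneous x 1 (y / x) (s / x)
    rw [mul_one, mul_div_cancel₀ y hx.ne', mul_div_cancel₀ s hx.ne'] at e
    rw [e]
    positivity

theorem condition1_of_potentialNonneg (h : P.PotentialNonneg) : P.Condition1 := by
  have hS : 0 ≤ P.lamS := by simpa [potential] using h 0 0 1 le_rfl le_rfl zero_le_one
  have h1 : 0 ≤ P.lam1 := by simpa [potential] using h 1 0 0 zero_le_one le_rfl le_rfl
  have h2 : 0 ≤ P.lam2 := by simpa [potential] using h 0 1 0 le_rfl zero_le_one le_rfl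
  refine ⟨hS, h1, h2, neg_two_mul_sqrt_le h1 h2 fun x y hx hy => ?_,
    neg_two_mul_sqrt_le hS h1 fun x y hx hy => ?_, neg_two_mul_sqrt_le hS h2 fun x y hx hy => ?_⟩
  · refine (h x y 0 hx hy le_rfl).trans_eq ?_
    unfold potential
    ring
  · refine (h y 0 x hy le_rfl hx).trans_eq ?_
    unfold potential
    ring
  · refine (h 0 y x le_rfl hy hx).trans_eq ?_
    unfold potential
    ring

/-! ### The region where `α` is negative -/

theorem alpha_nonneg_of_caseA (h : P.CaseA) {t : ℝ} (ht : 0 < t) : 0 ≤ P.alpha 1 t := by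
  obtain ⟨h1, h2, h3⟩ := h
  have := quadratic_nonneg_of_neg_two_mul_sqrt_le h1 h2
    (b := -(|P.lamS12| * P.rho)) (by linarith) zero_le_one ht.le
  unfold alpha
  nlinarith

theorem abs_mul_rho_sq : (|P.lamS12| * P.rho) ^ 2 = P.disc + 4 * P.lamS1 * P.lamS2 := by
  rw [mul_pow, sq_abs, disc]
  ring

theorem alpha_eq_of_disc_pos (h2 : P.lamS2 ≠ 0) (hd : 0 < P.disc) (t : ℝ) :
    P.alpha 1 t = P.lamS2 * ((t - P.tMinus) * (t - P.tPlus)) := by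
  have h := P.abs_mul_rho_sq
  have hs := Real.sq_sqrt hd.le
  unfold alpha tMinus tPlus
  field_simp
  linear_combination -h + hs

theorem forall_eval_g1_nonneg_iff (hrho : 0 ≤ P.rho) (h : P.SideC) :
    (∀ u : ℝ, 0 < u → 0 ≤ P.g1.eval u) ↔
      ∀ t : ℝ, 0 < t → P.alpha 1 t < 0 → 0 ≤ P.g.eval t := by
  obtain ⟨h2, hk, -⟩ := h
  have hk0 : 0 < |P.lamS12| * P.rho := lt_of_le_of_ne (by positivity) hk.symm
  rw [g1, forall_eval_shift_nonneg_iff]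
  refine forall_congr' fun t => ?_
  rw [lamBar, max_lt_iff, div_lt_iff₀ hk0, alpha, h2]
  constructor
  · intro h ht hα
    exact h ⟨by linarith, ht⟩
  · rintro h ⟨h1, ht⟩
    exact h ht (by linarith)

theorem forall_eval_g3_nonneg_iff (hrho : 0 ≤ P.rho) (h : P.SideD) :
    (∀ u : ℝ, 0 < u → 0 ≤ P.g3.eval u) ↔
      ∀ t : ℝ, 0 < t → P.alpha 1 t < 0 → 0 ≤ P.g.eval t := by
  obtain ⟨h2, hd⟩ := h
  have hs := Real.sqrt_pos.2 hd
  have hk : 0 ≤ |P.lamS12| * P.rho := by positivity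
  have hlt : P.tMinus < P.tPlus := by
    unfold tMinus tPlus
    gcongr
    linarith
  have hpos : 0 < P.tPlus := by
    unfold tPlus
    positivity
  have hbar : P.tBar < P.tPlus := max_lt hlt hpos
  rw [g3, g2, forall_eval_shift_invert_nonneg_iff (natDegree_g_le P) hbar]
  refine forall_congr' fun t => ?_
  rw [tBar, max_lt_iff, alpha_eq_of_disc_pos h2.ne' hd]
  constructor
  · intro h ht hα
    obtain ⟨h3, h4⟩ := (mul_sub_mul_sub_neg_iff h2 hlt.le).1 hα
    exact h ⟨h3, ht⟩ h4
  · rintro h ⟨h3, ht⟩ h4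
    exact h ht ((mul_sub_mul_sub_neg_iff h2 hlt.le).2 ⟨h3, h4⟩)

/-- Here `α(1, t) < 0` iff `t > tMinus`, for `t > 0`. The quartic `g₄` tests `g` on the interval
`(tMinus, 2 tMinus - tPlus)` and `g₅` tests it on `(-tPlus, ∞)`. As
`tMinus ≤ -tPlus ≤ 2 tMinus - tPlus`, the two sets cover `(tMinus, ∞)`, except for the point
`-tPlus` if `tMinus = 0`. -/
theorem forall_eval_g4_g5_nonneg_iff (hrho : 0 ≤ P.rho) (h : P.SideE) :
    ((∀ u : ℝ, 0 < u → 0 ≤ P.g4.eval u) ∧ ∀ u : ℝ, 0 < u → 0 ≤ P.g5.eval u) ↔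
      ∀ t : ℝ, 0 < t → P.alpha 1 t < 0 → 0 ≤ P.g.eval t := by
  obtain ⟨h2, hd, h0⟩ := h
  have hs := Real.sqrt_pos.2 hd
  have hk : 0 ≤ |P.lamS12| * P.rho := by positivity
  have hneg : P.tPlus < 0 := div_neg_of_pos_of_neg (by linarith) (by linarith)
  have hsum : P.tMinus ≤ -P.tPlus := by
    have : P.tMinus + P.tPlus = |P.lamS12| * P.rho / P.lamS2 := by
      unfold tMinus tPlus
      field_simp
      ring
    have := div_nonpos_of_nonneg_of_nonpos hk h2.le
    linarith
  have hα : ∀ t : ℝ, 0 < t → (P.alpha 1 t < 0 ↔ P.tMinus < t) := by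
    intro t ht
    rw [alpha_eq_of_disc_pos h2.ne hd, ← neg_pos, ← neg_mul, mul_pos_iff_of_pos_left
      (by linarith), mul_pos_iff_of_pos_right (by linarith), sub_pos]
  have e : -(1 / (P.tPlus - P.tMinus)) = 1 / ((2 * P.tMinus - P.tPlus) - P.tMinus) := by
    rw [← one_div_neg_eq_neg_one_div]
    congr 1
    ring
  rw [g4, g7, e, forall_eval_shift_invert_nonneg_iff (natDegree_g_le P) (by linarith), g5,
    forall_eval_shift_nonneg_iff]
  constructor
  · rintro ⟨h4, h5⟩ t ht hαt
    have hm := (hα t ht).1 hαt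
    rcases lt_or_ge t (2 * P.tMinus - P.tPlus) with hlt | hge
    · exact h4 t hm hlt
    · rcases (show -P.tPlus ≤ t by linarith).eq_or_lt with heq | hlt
      · exact heq ▸ eval_nonneg_of_forall_gt h5
      · exact h5 t hlt
  · intro h
    exact ⟨fun t h1 _ => h t (by linarith) ((hα t (by linarith)).2 h1),
      fun t h1 => h t (by linarith) ((hα t (by linarith)).2 (by linarith))⟩

/-! ### Exhaustiveness of the cases, and the theorem -/

theorem g_eq : P.g = C (4 * P.lamS * P.lam2 - P.lamS2 ^ 2) * X ^ 4
    + C (2 * (|P.lamS12| * P.rho) * P.lamS2) * X ^ 3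
    + C (4 * P.lamS * (P.lam3 + P.lam4 * P.rho ^ 2) - (|P.lamS12| * P.rho) ^ 2
      - 2 * P.lamS1 * P.lamS2) * X ^ 2
    + C (2 * P.lamS1 * (|P.lamS12| * P.rho)) * X + C (4 * P.lamS * P.lam1 - P.lamS1 ^ 2) := by
  simp only [g, C_add, C_sub, C_mul, C_pow, C_ofNat]
  ring

theorem coeff_four_g : P.g.coeff 4 = 4 * P.lamS * P.lam2 - P.lamS2 ^ 2 := by
  rw [g_eq]
  simp only [coeff_add, coeff_C_mul, coeff_X_pow, coeff_X, coeff_C]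
  norm_num

theorem coeff_three_g : P.g.coeff 3 = 2 * (|P.lamS12| * P.rho) * P.lamS2 := by
  rw [g_eq]
  simp only [coeff_add, coeff_C_mul, coeff_X_pow, coeff_X, coeff_C]
  norm_num

theorem side_cases (hrho : 0 ≤ P.rho) (h1 : P.Condition1) (hA : ¬ P.CaseA) (hB : ¬ P.SideB) :
    P.SideC ∨ P.SideD ∨ P.SideE ∨ P.SideF := by
  have hk : 0 ≤ |P.lamS12| * P.rho := by positivity
  have hd := P.abs_mul_rho_sq
  rcases lt_trichotomy P.lamS2 0 with h2 | h2 | h2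
  · have hS1 : 0 < P.lamS1 := by
      by_contra! h
      exact hB ⟨h, h2.le⟩
    have : 0 < P.disc := by nlinarith
    rcases le_or_gt 0 P.tMinus with ht | ht
    · exact Or.inr (Or.inr (Or.inl ⟨h2, this, ht⟩))
    · exact Or.inr (Or.inr (Or.inr ⟨h2, this, ht⟩))
  · have hS1 : 0 < P.lamS1 := by
      by_contra! h
      exact hB ⟨h, h2.le⟩
    refine Or.inl ⟨h2, fun h0 => hA ⟨hS1.le, h2.ge, ?_⟩, ?_, ?_, ?_⟩
    · rw [h0]
      positivity
    · rw [coeff_four_g, h2]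
      ring
    · exact mul_nonneg (mul_nonneg (by norm_num) h1.1) h1.2.2.1
    · rw [coeff_three_g, h2, mul_zero]
  · refine Or.inr (Or.inl ⟨h2, ?_⟩)
    by_contra! hle
    have h12 : 0 ≤ P.lamS1 := by
      have : 0 ≤ 4 * P.lamS1 * P.lamS2 := by nlinarith
      nlinarith
    refine hA ⟨h12, h2.le, ?_⟩
    have := Real.le_sqrt_of_sq_le (show (|P.lamS12| * P.rho) ^ 2 ≤ 2 ^ 2 * (P.lamS1 * P.lamS2) by
      linarith)
    rwa [Real.sqrt_mul (by norm_num), Real.sqrt_sq (by norm_num)] at this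

/-- The last case is contained in the case `λ_{S1}, λ_{S2} ≤ 0`. -/
theorem sideB_of_sideF (hrho : 0 ≤ P.rho) (h : P.SideF) : P.SideB := by
  obtain ⟨h2, hd, ht⟩ := h
  refine ⟨?_, h2.le⟩
  have hk : 0 ≤ |P.lamS12| * P.rho := by positivity
  have h3 := P.abs_mul_rho_sq
  have hs := Real.sq_sqrt hd.le
  have hs0 := Real.sqrt_pos.2 hd
  have h4 : √P.disc < |P.lamS12| * P.rho := by
    by_contra! hle
    exact ht.not_ge (div_nonneg_of_nonpos (by linarith) (by linarith))
  nlinarith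

theorem tPlus_neg_of_sideF (hrho : 0 ≤ P.rho) (h : P.SideF) : P.tPlus < 0 := by
  have hk : 0 ≤ |P.lamS12| * P.rho := by positivity
  have hs := Real.sqrt_pos.2 h.2.1
  exact div_neg_of_pos_of_neg (by linarith) (by linarith [h.1])

theorem natDegree_g1_le : P.g1.natDegree ≤ 4 := natDegree_shift_le (natDegree_g_le P) _

theorem natDegree_g3_le : P.g3.natDegree ≤ 4 :=
  natDegree_shift_le (natDegree_invert_le (natDegree_g_le P) _) _

theorem natDegree_g4_le : P.g4.natDegree ≤ 4 :=
  natDegree_shift_le (natDegree_invert_le (natDegree_g_le P) _) _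

theorem natDegree_g5_le : P.g5.natDegree ≤ 4 := natDegree_shift_le (natDegree_g_le P) _

theorem natDegree_g6_le : P.g6.natDegree ≤ 4 := natDegree_shift_le (natDegree_g_le P) _

theorem potentialNonneg_of_conditions (hrho : 0 ≤ P.rho) (h1 : P.Condition1)
    (h2 : P.Condition2) : P.PotentialNonneg := by
  rw [potentialNonneg_iff h1]
  rcases h2 with h | ⟨-, h⟩ | ⟨hC, h⟩ | ⟨hD, h⟩ | ⟨hE, h4, h5⟩ | ⟨hF, h⟩
  · exact fun t ht hα => absurd (alpha_nonneg_of_caseA h ht) hα.not_ge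
  · exact fun t ht _ => eval_nonneg_of_satisfiesUW (natDegree_g_le P) h ht
  · exact (forall_eval_g1_nonneg_iff hrho hC).1
      fun u hu => eval_nonneg_of_satisfiesUW natDegree_g1_le h hu
  · exact (forall_eval_g3_nonneg_iff hrho hD).1
      fun u hu => eval_nonneg_of_satisfiesUW natDegree_g3_le h hu
  · exact (forall_eval_g4_g5_nonneg_iff hrho hE).1
      ⟨fun u hu => eval_nonneg_of_satisfiesUW natDegree_g4_le h4 hu,
        fun u hu => eval_nonneg_of_satisfiesUW natDegree_g5_le h5 hu⟩
  · have h6 := (forall_eval_shift_nonneg_iff _ _).1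
      fun u hu => eval_nonneg_of_satisfiesUW (P.natDegree_g6_le) h hu
    exact fun t ht _ => h6 t ((tPlus_neg_of_sideF hrho hF).trans ht)

theorem alpha_nonpos_of_sideB (hrho : 0 ≤ P.rho) (h : P.SideB) {t : ℝ} (ht : 0 < t) :
    P.alpha 1 t ≤ 0 := by
  have hk : 0 ≤ |P.lamS12| * P.rho * t := by positivity
  have := mul_nonneg (neg_nonneg.2 h.2) (sq_nonneg t)
  unfold alpha
  linarith [h.1]

theorem condition2_of_potentialNonneg (hrho : 0 ≤ P.rho) (hN : P.Nondegenerate)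
    (h : P.PotentialNonneg) : P.Condition2 := by
  have h1 := condition1_of_potentialNonneg h
  have hg := (potentialNonneg_iff h1).1 h
  rcases hN with hA | ⟨hNB, hN⟩
  · exact Or.inl hA
  by_cases hA : P.CaseA
  · exact Or.inl hA
  by_cases hB : P.SideB
  · refine Or.inr (Or.inl ⟨hB, satisfiesUW_of_eval_nonneg (natDegree_g_le P) (hNB hB)
      fun t ht => ?_⟩)
    rcases (alpha_nonpos_of_sideB hrho hB ht).eq_or_lt with hα | hα
    -- Where `α` vanishes, `g = 4 λ_S β`.
    · rw [eval_g, hα]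
      have := beta_nonneg h1 1 t
      have := h1.1
      norm_num
      positivity
    · exact hg t ht hα
  · obtain ⟨hNC, hND, hNE, -⟩ := hN hB
    rcases side_cases hrho h1 hA hB with hC | hD | hE | hF
    · exact Or.inr (Or.inr (Or.inl ⟨hC, satisfiesUW_of_eval_nonneg natDegree_g1_le (hNC hC)
        ((forall_eval_g1_nonneg_iff hrho hC).2 hg)⟩))
    · exact Or.inr (Or.inr (Or.inr (Or.inl ⟨hD, satisfiesUW_of_eval_nonneg natDegree_g3_le
        (hND hD) ((forall_eval_g3_nonneg_iff hrho hD).2 hg)⟩)))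
    · obtain ⟨h4, h5⟩ := (forall_eval_g4_g5_nonneg_iff hrho hE).2 hg
      exact Or.inr (Or.inr (Or.inr (Or.inr (Or.inl ⟨hE,
        satisfiesUW_of_eval_nonneg natDegree_g4_le (hNE hE).1 h4,
        satisfiesUW_of_eval_nonneg natDegree_g5_le (hNE hE).2 h5⟩))))
    · exact absurd (sideB_of_sideF hrho hF) hB

end Params

end Z3DarkMatter

theorem theorem5p2 (P : Z3DarkMatter.Params) (hrho0 : 0 ≤ P.rho) (hrho1 : P.rho ≤ 1) :
    (P.Condition1 ∧ P.Condition2 → P.PotentialNonneg) ∧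
    (P.PotentialNonneg → P.Condition1) ∧
    (P.Nondegenerate → (P.PotentialNonneg ↔ P.Condition1 ∧ P.Condition2)) := by
  have suff : P.Condition1 ∧ P.Condition2 → P.PotentialNonneg := fun h =>
    Z3DarkMatter.Params.potentialNonneg_of_conditions hrho0 h.1 h.2
  refine ⟨suff, Z3DarkMatter.Params.condition1_of_potentialNonneg, fun hN => ⟨fun h => ?_, suff⟩⟩
  exact ⟨Z3DarkMatter.Params.condition1_of_potentialNonneg h,
    Z3DarkMatter.Params.condition2_of_potentialNonneg hrho0 hN h⟩
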